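/- Let $\Omega=(0,1)\times(0,1)\subset\mathbb R^2$ and let $h:[0,1]\to\mathbb R$ be a bounded function with $h(0)=0$, $h>0$ on $(0,1]$ and $h\in C^1(0,1]$. Suppose that for some $\theta\in(0,1)$ there is a constant $C$ such that $$\sup_{x\in\Omega,\ 0<r\le d}\ \frac{\int_{B(x,r)\cap\Omega}h(y_1)^{-1}\,dy}{|B(x,r)\cap\Omega|^{\theta}}\le C,$$ where $B(x,r)$ is the Euclidean ball with centre $x$ and radius $r$, $d$ is the diameter of $\Omega$ and $|\cdot|$ is Lebesgue measure (in particular, $\int_{B(x,r)\cap\Omega}h(y_1)^{-1}\,dy$ is finite for all such $x$ and $r$). Let $$\mathcal H^1_h(\Omega)=\Bigl\{u\in L^2(\Omega)\ :\ \partial_{x_1}u\in L^2(\Omega),\ \sqrt{h(x_1)}\,\partial_{x_2}u\in L^2(\Omega)\Bigr\},$$ $$\|u\|_{\mathcal H^1_h(\Omega)}=\Bigl(\|u\|_{L^2(\Omega)}^2+\|\partial_{x_1}u\|_{L^2(\Omega)}^2+\bigl\|\sqrt{h(x_1)}\,\partial_{x_2}u\bigr\|_{L^2(\Omega)}^2\Bigr)^{1/2},$$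 where $\partial_{x_1}u$ and $\partial_{x_2}u$ are weak derivatives in $\Omega$ (locally integrable functions), and let $\mathcal H^1_{h,0}(\Omega)$ be the closure of $C_0^\infty(\Omega)$ in $\mathcal H^1_h(\Omega)$, with the same norm. All functions are real-valued. Then the embedding $\mathcal H^1_{h,0}(\Omega)\hookrightarrow L^2(\Omega)$, $u\mapsto u$, is compact: it is an injective bounded linear map, and every bounded sequence in $\mathcal H^1_{h,0}(\Omega)$ has a subsequence that converges in $L^2(\Omega)$. -/

import Mathlib

open MeasureTheory Set TopologicalSpace
open scoped Distributions

namespace WeightedSobolev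

/-- The Euclidean plane `ℝ²`. -/
abbrev Plane : Type := EuclideanSpace ℝ (Fin 2)

/-- The open unit square `Ω = (0,1) × (0,1)`. The coordinates `x₁`, `x₂` of a point `x` of the
plane are `x 0`, `x 1`. -/
def unitSquare : Opens Plane where
  carrier := {x | x 0 ∈ Ioo (0 : ℝ) 1 ∧ x 1 ∈ Ioo (0 : ℝ) 1}
  is_open' := by
    refine IsOpen.inter ?_ ?_
    · exact isOpen_Ioo.preimage (by fun_prop : Continuous fun x : Plane => x 0)
    · exact isOpen_Ioo.preimage (by fun_prop : Continuous fun x : Plane => x 1)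

/-- `Ω` as a set. -/
abbrev Ω : Set Plane := (unitSquare : Set Plane)

/-- Lebesgue measure on `Ω`. -/
noncomputable abbrev μΩ : Measure Plane := (volume : Measure Plane).restrict Ω

/-- The real Hilbert space `L²(Ω)`. -/
abbrev L2Ω : Type := Lp ℝ 2 μΩ

/-- The classical partial derivative `∂ᵢ φ`. -/
noncomputable def partialDeriv (i : Fin 2) (φ : Plane → ℝ) (x : Plane) : ℝ :=
  fderiv ℝ φ x (EuclideanSpace.single i 1)

/-- `g` is a weak partial derivative `∂ᵢ u` of `u` in `Ω`. -/
def HasWeakPartial (i : Fin 2) (u : L2Ω) (g : Plane → ℝ) : Prop :=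
  LocallyIntegrableOn g Ω ∧
    ∀ φ : 𝓓(unitSquare, ℝ),
      ∫ x in Ω, u x * partialDeriv i φ x = -∫ x in Ω, g x * φ x

theorem integrableOn_mul_test {g : Plane → ℝ} (hg : LocallyIntegrableOn g Ω)
    (φ : 𝓓(unitSquare, ℝ)) : IntegrableOn (fun x => g x * φ x) Ω := by
  have h1 : IntegrableOn (fun x => φ x * g x) (tsupport φ) :=
    IntegrableOn.continuousOn_mul φ.continuous.continuousOn
      (hg.integrableOn_compact_subset φ.tsupport_subset φ.hasCompactSupport) φ.hasCompactSupport
  have h2 : Integrable (fun x => φ x * g x) := by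
    refine (integrableOn_iff_integrable_of_support_subset ?_).1 h1
    intro x hx
    refine subset_tsupport _ ?_
    intro h0
    exact hx (by simp [h0])
  simpa only [mul_comm] using h2.integrableOn

theorem integrableOn_mul_partialDeriv (i : Fin 2) (u : L2Ω) (φ : 𝓓(unitSquare, ℝ)) :
    IntegrableOn (fun x => u x * partialDeriv i φ x) Ω := by
  have hc : Continuous (partialDeriv i φ) :=
    (φ.contDiff.continuous_fderiv (by simp)).clm_apply continuous_const
  have hs : HasCompactSupport (partialDeriv i φ) :=
    φ.hasCompactSupport.fderiv_apply ℝ (EuclideanSpace.single i 1)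
  have hm : MemLp (partialDeriv i φ) 2 μΩ := (hc.memLp_of_hasCompactSupport hs).restrict Ω
  exact (Lp.memLp u).integrable_mul hm

theorem HasWeakPartial.ae_eq {i : Fin 2} {u : L2Ω} {g₁ g₂ : Plane → ℝ}
    (h₁ : HasWeakPartial i u g₁) (h₂ : HasWeakPartial i u g₂) : g₁ =ᵐ[μΩ] g₂ := by
  have key := unitSquare.isOpen.ae_eq_zero_of_integral_contDiff_smul_eq_zero (μ := volume)
    (h₁.1.sub h₂.1) (fun f hf hf' hf'' => by
      let φ : 𝓓(unitSquare, ℝ) := ⟨f, hf, hf', hf''⟩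
      have e₁ : ∫ x in Ω, g₁ x * f x = ∫ x in Ω, g₂ x * f x := by
        have a := h₁.2 φ
        have b := h₂.2 φ
        exact neg_injective (a.symm.trans b)
      have i₁ : IntegrableOn (fun x => g₁ x * f x) Ω := integrableOn_mul_test h₁.1 φ
      have i₂ : IntegrableOn (fun x => g₂ x * f x) Ω := integrableOn_mul_test h₂.1 φ
      have e₂ : ∫ x in Ω, f x • (g₁ - g₂) x = ∫ x, f x • (g₁ - g₂) x := by
        refine setIntegral_eq_integral_of_forall_compl_eq_zero fun x hx => ?_
        have : f x = 0 := image_eq_zero_of_notMem_tsupport fun h => hx (hf'' h)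
        simp [this]
      rw [← e₂]
      have e₃ : ∀ x, f x • (g₁ - g₂) x = g₁ x * f x - g₂ x * f x := by
        intro x
        simp only [Pi.sub_apply, smul_eq_mul]
        ring
      simp only [e₃]
      rw [integral_sub i₁ i₂, e₁, sub_self])
  rw [Filter.EventuallyEq, ae_restrict_iff' unitSquare.isOpen.measurableSet]
  filter_upwards [key] with x hx hxΩ
  exact sub_eq_zero.1 (hx hxΩ)

theorem HasWeakPartial.add {i : Fin 2} {u v : L2Ω} {g k : Plane → ℝ}
    (h₁ : HasWeakPartial i u g) (h₂ : HasWeakPartial i v k) :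
    HasWeakPartial i (u + v) (g + k) := by
  refine ⟨h₁.1.add h₂.1, fun φ => ?_⟩
  have e : ∫ x in Ω, (u + v : L2Ω) x * partialDeriv i φ x
      = ∫ x in Ω, (u x * partialDeriv i φ x + v x * partialDeriv i φ x) := by
    refine integral_congr_ae ?_
    filter_upwards [Lp.coeFn_add u v] with x hx
    rw [hx, Pi.add_apply, add_mul]
  rw [e, integral_add (integrableOn_mul_partialDeriv i u φ) (integrableOn_mul_partialDeriv i v φ),
    h₁.2 φ, h₂.2 φ, ← neg_add,
    ← integral_add (integrableOn_mul_test h₁.1 φ) (integrableOn_mul_test h₂.1 φ)]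
  simp only [Pi.add_apply, add_mul]

theorem HasWeakPartial.smul {i : Fin 2} {u : L2Ω} {g : Plane → ℝ} (c : ℝ)
    (h : HasWeakPartial i u g) : HasWeakPartial i (c • u) (c • g) := by
  refine ⟨h.1.smul c, fun φ => ?_⟩
  have e : ∫ x in Ω, (c • u : L2Ω) x * partialDeriv i φ x
      = ∫ x in Ω, c * (u x * partialDeriv i φ x) := by
    refine integral_congr_ae ?_
    filter_upwards [Lp.coeFn_smul c u] with x hx
    rw [hx, Pi.smul_apply, smul_eq_mul, mul_assoc]
  rw [e, integral_const_mul, h.2 φ]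
  simp only [Pi.smul_apply, smul_eq_mul, mul_assoc, integral_const_mul, mul_neg]

theorem HasWeakPartial.zero (i : Fin 2) : HasWeakPartial i 0 0 := by
  refine ⟨locallyIntegrableOn_zero, fun φ => ?_⟩
  have e : ∫ x in Ω, (0 : L2Ω) x * partialDeriv i φ x = ∫ x in Ω, (0 : ℝ) := by
    refine integral_congr_ae ?_
    filter_upwards [Lp.coeFn_zero ℝ 2 μΩ] with x hx
    rw [hx, Pi.zero_apply, zero_mul]
  rw [e]
  simp

/-- The weights of the two partial derivatives: `1` for `∂₁` and `√h(x₁)` for `∂₂`. -/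
noncomputable def weight (h : ℝ → ℝ) (i : Fin 2) (x : Plane) : ℝ :=
  if i = 0 then 1 else √(h (x 0))

/-- The set `ℋ¹_h(Ω) = {u ∈ L²(Ω) : ∂₁u ∈ L²(Ω), √h(x₁) ∂₂u ∈ L²(Ω)}`, as a linear subspace
of `L²(Ω)` (without its own norm). -/
noncomputable def H1Submodule (h : ℝ → ℝ) : Submodule ℝ L2Ω where
  carrier := {u | ∀ i : Fin 2, ∃ g : Plane → ℝ,
    HasWeakPartial i u g ∧ MemLp (fun x => weight h i x * g x) 2 μΩ}
  add_mem' := by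
    intro u v hu hv i
    obtain ⟨g, hg, hg'⟩ := hu i
    obtain ⟨k, hk, hk'⟩ := hv i
    refine ⟨g + k, hg.add hk, ?_⟩
    have e : (fun x => weight h i x * (g + k) x)
        = (fun x => weight h i x * g x) + fun x => weight h i x * k x := by
      funext x
      exact mul_add _ _ _
    rw [e]
    exact hg'.add hk'
  zero_mem' := by
    intro i
    refine ⟨0, HasWeakPartial.zero i, ?_⟩
    simp only [Pi.zero_apply, mul_zero]
    exact MemLp.zero'
  smul_mem' := by
    intro c u hu i
    obtain ⟨g, hg, hg'⟩ := hu i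
    refine ⟨c • g, hg.smul c, ?_⟩
    have e : (fun x => weight h i x * (c • g) x) = c • fun x => weight h i x * g x := by
      funext x
      simp only [Pi.smul_apply, smul_eq_mul, mul_left_comm]
    rw [e]
    exact hg'.const_smul c

/-- The space `ℋ¹_h(Ω)`. It is a separate type, so that it carries its own norm and not the one
of `L²(Ω)`. -/
def H1 (h : ℝ → ℝ) : Type := H1Submodule h

namespace H1

variable {h : ℝ → ℝ}

noncomputable instance : AddCommGroup (H1 h) := inferInstanceAs (AddCommGroup (H1Submodule h))

noncomputable instance : Module ℝ (H1 h) := inferInstanceAs (Module ℝ (H1Submodule h))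

/-- The inclusion `ℋ¹_h(Ω) ⊆ L²(Ω)`. -/
noncomputable def toL2 : H1 h →ₗ[ℝ] L2Ω := (H1Submodule h).subtype

/-- The weak partial derivative `∂ᵢ u`, a function that is unique almost everywhere in `Ω`. -/
noncomputable def weakPartial (i : Fin 2) (u : H1 h) : Plane → ℝ :=
  Classical.choose (u.2 i)

theorem hasWeakPartial (i : Fin 2) (u : H1 h) : HasWeakPartial i (toL2 u) (weakPartial i u) :=
  (Classical.choose_spec (u.2 i)).1

theorem memLp_weakPartial (i : Fin 2) (u : H1 h) :
    MemLp (fun x => weight h i x * weakPartial i u x) 2 μΩ :=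
  (Classical.choose_spec (u.2 i)).2

/-- `∂₁ u` (for `i = 0`) and `√h(x₁) ∂₂ u` (for `i = 1`) as elements of `L²(Ω)`. -/
noncomputable def weightedPartial (i : Fin 2) : H1 h →ₗ[ℝ] L2Ω where
  toFun u := (memLp_weakPartial i u).toLp
  map_add' u v := by
    rw [← MemLp.toLp_add, MemLp.toLp_eq_toLp_iff]
    have e := (hasWeakPartial i (u + v)).ae_eq
      (((map_add (toL2 (h := h)) u v).symm) ▸ (hasWeakPartial i u).add (hasWeakPartial i v))
    filter_upwards [e] with x hx
    rw [hx, Pi.add_apply, Pi.add_apply, mul_add]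
  map_smul' c u := by
    rw [RingHom.id_apply, ← MemLp.toLp_const_smul, MemLp.toLp_eq_toLp_iff]
    have e := (hasWeakPartial i (c • u)).ae_eq
      (((map_smul (toL2 (h := h)) c u).symm) ▸ (hasWeakPartial i u).smul c)
    filter_upwards [e] with x hx
    rw [hx, Pi.smul_apply, Pi.smul_apply, smul_eq_mul, smul_eq_mul, mul_left_comm]

/-- The map `u ↦ (u, ∂₁u, √h(x₁) ∂₂u)` into the Hilbert space `L²(Ω)³`. -/
noncomputable def jet : H1 h →ₗ[ℝ] PiLp 2 (fun _ : Fin 3 => L2Ω) :=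
  (WithLp.linearEquiv 2 ℝ (Fin 3 → L2Ω)).symm.toLinearMap ∘ₗ
    LinearMap.pi ![toL2, weightedPartial 0, weightedPartial 1]

theorem jet_injective : Function.Injective (jet (h := h)) := by
  intro u v huv
  have := congrArg (fun p : PiLp 2 (fun _ : Fin 3 => L2Ω) => p 0) huv
  exact Subtype.ext this

/-- The norm of `ℋ¹_h(Ω)` is that of `(u, ∂₁u, √h(x₁) ∂₂u)`: see `norm_eq`. -/
noncomputable instance : NormedAddCommGroup (H1 h) :=
  NormedAddCommGroup.induced (H1 h) (PiLp 2 (fun _ : Fin 3 => L2Ω)) jet jet_injective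

noncomputable instance : NormedSpace ℝ (H1 h) :=
  NormedSpace.induced ℝ (H1 h) (PiLp 2 (fun _ : Fin 3 => L2Ω)) jet

theorem norm_eq (u : H1 h) :
    ‖u‖ = √(‖toL2 u‖ ^ 2 + ‖weightedPartial 0 u‖ ^ 2 + ‖weightedPartial 1 u‖ ^ 2) := by
  have : ‖u‖ = ‖jet u‖ := rfl
  rw [this, PiLp.norm_eq_of_L2, Fin.sum_univ_three]
  rfl

theorem norm_toL2_le (u : H1 h) : ‖toL2 u‖ ≤ ‖u‖ := by
  rw [norm_eq]
  refine Real.le_sqrt_of_sq_le ?_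
  nlinarith [sq_nonneg ‖weightedPartial 0 u‖, sq_nonneg ‖weightedPartial 1 u‖]

/-- The functions of class `C_0^∞(Ω)`, as elements of `ℋ¹_h(Ω)`. -/
def testFunctions (h : ℝ → ℝ) : Submodule ℝ (H1 h) where
  carrier := {u | ∃ φ : 𝓓(unitSquare, ℝ), toL2 u =ᵐ[μΩ] φ}
  add_mem' := by
    rintro u v ⟨φ, hφ⟩ ⟨ψ, hψ⟩
    refine ⟨φ + ψ, ?_⟩
    rw [map_add]
    filter_upwards [Lp.coeFn_add (toL2 u) (toL2 v), hφ, hψ] with x h1 h2 h3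
    rw [h1, Pi.add_apply, h2, h3]
    rfl
  zero_mem' := by
    refine ⟨0, ?_⟩
    rw [map_zero]
    exact Lp.coeFn_zero ℝ 2 μΩ
  smul_mem' := by
    rintro c u ⟨φ, hφ⟩
    refine ⟨c • φ, ?_⟩
    rw [map_smul]
    filter_upwards [Lp.coeFn_smul c (toL2 u), hφ] with x h1 h2
    rw [h1, Pi.smul_apply, h2]
    rfl

end H1

/-- The space `ℋ¹_{h,0}(Ω)`: the closure of `C_0^∞(Ω)` in `ℋ¹_h(Ω)`, with the norm of
`ℋ¹_h(Ω)`. -/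
noncomputable def H10 (h : ℝ → ℝ) : Submodule ℝ (H1 h) := (H1.testFunctions h).topologicalClosure

/-- The embedding `ℋ¹_{h,0}(Ω) ↪ L²(Ω)`, `u ↦ u`. -/
noncomputable def embedding (h : ℝ → ℝ) : H10 h →L[ℝ] L2Ω :=
  (H1.toL2 ∘ₗ (H10 h).subtype).mkContinuous 1 fun u => by
    rw [one_mul]
    exact H1.norm_toL2_le (u : H1 h)

end WeightedSobolev

namespace WeightedSobolev

/-! The weight `h` degenerates only at `x₁ = 0`, on an edge of the square where test functions
vanish; on `[1/(n+1), 1]` it has a positive minimum `c`. A test function `φ` is approximated by step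
functions on a grid of `n + 1` columns and `m + 1` rows. Column `j` receives a vertical line `x₁ = s
j` on which `∂₂φ` is controlled: the edge `x₁ = 0` for the first column, a line found by averaging
for the others (`exists_nodes`).

A point of a cell is joined to the node of the cell by a horizontal segment, which costs only `∂₁φ`,
followed by a vertical one along the chosen line. This gives (`exists_step_approx`) a squared error
of at most `2/(n+1) ‖∂₁u‖² + 2(n+1)/(c(m+1)) ‖√h ∂₂u‖²`, which is small for `n` large and then `m`
large. Bounded sets of test functions are thus uniformly close to finite-dimensional spaces, and
density carries this over to the closure. -/

/-! ### Total boundedness from finite-dimensional approximation. -/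

theorem totallyBounded_of_approx_finiteDimensional {E : Type*} [NormedAddCommGroup E]
    [NormedSpace ℝ E] {S : Set E} (hS : Bornology.IsBounded S)
    (happ : ∀ ε > 0, ∃ V : Submodule ℝ E, FiniteDimensional ℝ V ∧
      ∀ u ∈ S, ∃ v ∈ V, ‖u - v‖ < ε) : TotallyBounded S := by
  obtain ⟨R, hR⟩ := hS.subset_closedBall (0 : E)
  refine Metric.totallyBounded_iff.2 fun ε hε => ?_
  obtain ⟨V, hV, hSV⟩ := happ (ε / 2) (half_pos hε)
  have : ProperSpace V := FiniteDimensional.proper ℝ V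
  -- All approximants lie in one ball of `V`, compact since `V` is finite-dimensional; an `ε /
  -- 2`-net of it is an `ε`-net of `S`.
  have hK : IsCompact ((↑) '' Metric.closedBall (0 : V) (R + ε / 2) : Set E) :=
    (isCompact_closedBall _ _).image continuous_subtype_val
  obtain ⟨t, ht, htK⟩ := Metric.totallyBounded_iff.1 hK.totallyBounded (ε / 2) (half_pos hε)
  refine ⟨t, ht, fun u hu => ?_⟩
  obtain ⟨v, hvV, huv⟩ := hSV u hu
  have hvK : v ∈ ((↑) '' Metric.closedBall (0 : V) (R + ε / 2) : Set E) := by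
    refine ⟨⟨v, hvV⟩, ?_, rfl⟩
    rw [mem_closedBall_zero_iff, Submodule.coe_norm]
    have h1 : ‖u‖ ≤ R := mem_closedBall_zero_iff.1 (hR hu)
    have h2 := norm_sub_le u (u - v)
    rw [sub_sub_cancel] at h2
    simp only
    linarith
  obtain ⟨y, hy, hvy⟩ := mem_iUnion₂.1 (htK hvK)
  refine mem_iUnion₂.2 ⟨y, hy, ?_⟩
  have h1 := dist_triangle u v y
  rw [dist_eq_norm u v] at h1
  have h2 : dist v y < ε / 2 := hvy
  exact Metric.mem_ball.2 (by linarith)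

/-! ### The one-dimensional estimate. -/

theorem sq_sub_le_mul_integral_deriv_sq {g : ℝ → ℝ} (hg : ContDiff ℝ 1 g) {a b : ℝ}
    (ha : 0 ≤ a) (hab : a ≤ b) (hb : b ≤ 1) :
    (g b - g a) ^ 2 ≤ (b - a) * ∫ t in Ioo (0 : ℝ) 1, deriv g t ^ 2 := by
  rcases hab.eq_or_lt with rfl | hlt
  · simp
  have hc : Continuous (deriv g) := hg.continuous_deriv le_rfl
  have hftc : ∫ t in a..b, deriv g t = g b - g a :=
    intervalIntegral.integral_deriv_eq_sub (fun x _ => (hg.differentiable one_ne_zero) x)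
      (hc.intervalIntegrable _ _)
  set L := b - a with hL
  have hLpos : 0 < L := sub_pos.2 hlt
  set Δ := g b - g a
  -- Cauchy–Schwarz in variance form: the mean square deviation of `deriv g` from its mean slope `Δ
  -- / L` is nonnegative.
  have key : 0 ≤ ∫ t in a..b, (deriv g t - Δ / L) ^ 2 :=
    intervalIntegral.integral_nonneg hab fun _ _ => sq_nonneg _
  have e : ∫ t in a..b, (deriv g t - Δ / L) ^ 2
      = (∫ t in a..b, deriv g t ^ 2) - Δ ^ 2 / L := by
    have e1 : ∀ t, (deriv g t - Δ / L) ^ 2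
        = deriv g t ^ 2 - (2 * (Δ / L)) * deriv g t + (Δ / L) ^ 2 := fun t => by ring
    simp only [e1]
    rw [intervalIntegral.integral_add, intervalIntegral.integral_sub,
      intervalIntegral.integral_const_mul, hftc, intervalIntegral.integral_const, ← hL]
    · simp only [smul_eq_mul]
      field_simp
      ring
    all_goals exact Continuous.intervalIntegrable (by fun_prop) _ _
  have h2 : ∫ t in a..b, deriv g t ^ 2 ≤ ∫ t in Ioo (0 : ℝ) 1, deriv g t ^ 2 := by
    rw [intervalIntegral.integral_of_le hab, ← integral_Ioc_eq_integral_Ioo]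
    refine setIntegral_mono_set ?_ (.of_forall fun _ => sq_nonneg _)
      (Ioc_subset_Ioc ha hb).eventuallyLE
    exact (hc.pow 2).integrableOn_Ioc
  rw [e, sub_nonneg, div_le_iff₀ hLpos] at key
  nlinarith

theorem sq_sub_le_abs_mul_integral_deriv_sq {g : ℝ → ℝ} (hg : ContDiff ℝ 1 g) {a b : ℝ}
    (ha : a ∈ Icc (0 : ℝ) 1) (hb : b ∈ Icc (0 : ℝ) 1) :
    (g b - g a) ^ 2 ≤ |b - a| * ∫ t in Ioo (0 : ℝ) 1, deriv g t ^ 2 := by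
  rcases le_total a b with hab | hab
  · rw [abs_of_nonneg (sub_nonneg.2 hab)]
    exact sq_sub_le_mul_integral_deriv_sq hg ha.1 hab hb.2
  · rw [abs_sub_comm, abs_of_nonneg (sub_nonneg.2 hab), ← neg_sub (g a), neg_sq]
    exact sq_sub_le_mul_integral_deriv_sq hg hb.1 hab ha.2

/-! ### Integrals over the square as integrals over a product. -/

theorem measurePreserving_mk :
    MeasurePreserving (fun p : ℝ × ℝ => (!₂[p.1, p.2] : Plane)) := by
  have h := (PiLp.volume_preserving_toLp (Fin 2)).comp
    ((volume_preserving_finTwoArrow ℝ).symm)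
  exact h

theorem measurableEmbedding_mk :
    MeasurableEmbedding (fun p : ℝ × ℝ => (!₂[p.1, p.2] : Plane)) := by
  have h := (MeasurableEquiv.toLp 2 (Fin 2 → ℝ)).measurableEmbedding.comp
    (MeasurableEquiv.finTwoArrow (α := ℝ)).symm.measurableEmbedding
  exact h

/-- Lebesgue measure on `(0,1)`. -/
noncomputable abbrev unitMeasure : Measure ℝ := volume.restrict (Ioo (0 : ℝ) 1)

instance : IsProbabilityMeasure unitMeasure := ⟨by simp [unitMeasure]⟩

theorem measurePreserving_mk_restrict :
    MeasurePreserving (fun p : ℝ × ℝ => (!₂[p.1, p.2] : Plane))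
      (unitMeasure.prod unitMeasure) μΩ := by
  have h := measurePreserving_mk.restrict_preimage_emb measurableEmbedding_mk Ω
  have e : (fun p : ℝ × ℝ => (!₂[p.1, p.2] : Plane)) ⁻¹' Ω = Ioo 0 1 ×ˢ Ioo 0 1 := by
    ext p
    rfl
  rw [e] at h
  rw [unitMeasure, Measure.prod_restrict]
  exact h

theorem integral_μΩ (F : Plane → ℝ) :
    ∫ x, F x ∂μΩ = ∫ p, F !₂[p.1, p.2] ∂(unitMeasure.prod unitMeasure) :=
  (measurePreserving_mk_restrict.integral_comp measurableEmbedding_mk F).symm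

theorem integrable_μΩ {F : Plane → ℝ} (hF : Integrable F μΩ) :
    Integrable (fun p : ℝ × ℝ => F !₂[p.1, p.2]) (unitMeasure.prod unitMeasure) :=
  (measurePreserving_mk_restrict.integrable_comp_emb measurableEmbedding_mk).2 hF

instance : IsProbabilityMeasure μΩ := by
  rw [← measurePreserving_mk_restrict.map_eq]
  exact Measure.isProbabilityMeasure_map measurePreserving_mk_restrict.aemeasurable

theorem norm_sq_L2Ω (u : L2Ω) : ‖u‖ ^ 2 = ∫ x, u x ^ 2 ∂μΩ := by
  rw [← real_inner_self_eq_norm_sq, L2.inner_def]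
  simp [pow_two]

/-! ### Weak derivatives and slices of test functions. -/

/-- Integration by parts on the whole plane, where both functions vanish off `Ω`. By uniqueness of
weak derivatives, the arbitrary choice in `weakPartial` can then be replaced by the classical
derivative. -/
theorem hasWeakPartial_testFunction (i : Fin 2) {u : L2Ω} {φ : 𝓓(unitSquare, ℝ)}
    (hu : u =ᵐ[μΩ] φ) : HasWeakPartial i u (partialDeriv i φ) := by
  have hc : Continuous (partialDeriv i φ) :=
    (φ.contDiff.continuous_fderiv (by simp)).clm_apply continuous_const
  refine ⟨hc.locallyIntegrable.locallyIntegrableOn _, fun ψ => ?_⟩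
  have hcψ : Continuous (partialDeriv i ψ) :=
    (ψ.contDiff.continuous_fderiv (by simp)).clm_apply continuous_const
  have hz : ∀ x ∉ Ω, φ x = 0 := fun x hx =>
    image_eq_zero_of_notMem_tsupport fun h => hx (φ.tsupport_subset h)
  have hzψ : ∀ x ∉ Ω, ψ x = 0 := fun x hx =>
    image_eq_zero_of_notMem_tsupport fun h => hx (ψ.tsupport_subset h)
  have e1 : ∫ x in Ω, u x * partialDeriv i ψ x = ∫ x in Ω, φ x * partialDeriv i ψ x := by
    refine integral_congr_ae ?_
    filter_upwards [hu] with x hx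
    rw [hx]
  rw [e1, setIntegral_eq_integral_of_forall_compl_eq_zero fun x hx => by rw [hz x hx, zero_mul],
    setIntegral_eq_integral_of_forall_compl_eq_zero fun x hx => by rw [hzψ x hx, mul_zero]]
  refine integral_mul_fderiv_eq_neg_fderiv_mul_of_integrable ?_ ?_ ?_
    (fun x _ => φ.contDiff.differentiable (by simp) x)
    (fun x _ => ψ.contDiff.differentiable (by simp) x)
  · exact (hc.mul ψ.continuous).integrable_of_hasCompactSupport ψ.hasCompactSupport.mul_left
  · exact (φ.continuous.mul hcψ).integrable_of_hasCompactSupport φ.hasCompactSupport.mul_right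
  · exact (φ.continuous.mul ψ.continuous).integrable_of_hasCompactSupport
      φ.hasCompactSupport.mul_right

theorem memLp_weight_mul_partialDeriv {h : ℝ → ℝ} (i : Fin 2) {u : H1 h} {φ : 𝓓(unitSquare, ℝ)}
    (hu : H1.toL2 u =ᵐ[μΩ] φ) :
    MemLp (fun x => weight h i x * partialDeriv i φ x) 2 μΩ := by
  refine (H1.memLp_weakPartial i u).ae_eq ?_
  filter_upwards [(H1.hasWeakPartial i u).ae_eq (hasWeakPartial_testFunction i hu)] with x hx
  rw [hx]

theorem norm_sq_weightedPartial {h : ℝ → ℝ} (i : Fin 2) {u : H1 h} {φ : 𝓓(unitSquare, ℝ)}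
    (hu : H1.toL2 u =ᵐ[μΩ] φ) :
    ‖H1.weightedPartial i u‖ ^ 2 = ∫ x, (weight h i x * partialDeriv i φ x) ^ 2 ∂μΩ := by
  rw [norm_sq_L2Ω]
  refine integral_congr_ae ?_
  filter_upwards [(H1.hasWeakPartial i u).ae_eq (hasWeakPartial_testFunction i hu),
    (H1.memLp_weakPartial i u).coeFn_toLp] with x hx hx'
  rw [← hx, ← hx']
  rfl

theorem norm_weightedPartial_le {h : ℝ → ℝ} (i : Fin 2) (u : H1 h) :
    ‖H1.weightedPartial i u‖ ≤ ‖u‖ := by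
  rw [H1.norm_eq]
  refine Real.le_sqrt_of_sq_le ?_
  fin_cases i
  · show ‖H1.weightedPartial 0 u‖ ^ 2 ≤ _
    nlinarith [sq_nonneg ‖H1.toL2 u‖, sq_nonneg ‖H1.weightedPartial 1 u‖]
  · show ‖H1.weightedPartial 1 u‖ ^ 2 ≤ _
    nlinarith [sq_nonneg ‖H1.toL2 u‖, sq_nonneg ‖H1.weightedPartial 0 u‖]

theorem contDiff_mk_fst (t : ℝ) : ContDiff ℝ 1 fun s : ℝ => (!₂[s, t] : Plane) := by
  rw [contDiff_euclidean]
  intro i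
  fin_cases i
  · exact contDiff_id
  · exact contDiff_const

theorem contDiff_mk_snd (s : ℝ) : ContDiff ℝ 1 fun t : ℝ => (!₂[s, t] : Plane) := by
  rw [contDiff_euclidean]
  intro i
  fin_cases i
  · exact contDiff_const
  · exact contDiff_id

theorem hasDerivAt_mk_fst (s t : ℝ) :
    HasDerivAt (fun s : ℝ => (!₂[s, t] : Plane)) (EuclideanSpace.single 0 1) s := by
  have e : (fun s : ℝ => (!₂[s, t] : Plane))
      = fun s => s • EuclideanSpace.single 0 (1 : ℝ) + !₂[0, t] := by
    funext s
    ext i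
    fin_cases i <;> simp
  rw [e]
  simpa using ((hasDerivAt_id s).smul_const (EuclideanSpace.single 0 (1 : ℝ) : Plane)).add_const
    (!₂[0, t] : Plane)

theorem hasDerivAt_mk_snd (s t : ℝ) :
    HasDerivAt (fun t : ℝ => (!₂[s, t] : Plane)) (EuclideanSpace.single 1 1) t := by
  have e : (fun t : ℝ => (!₂[s, t] : Plane))
      = fun t => t • EuclideanSpace.single 1 (1 : ℝ) + !₂[s, 0] := by
    funext t
    ext i
    fin_cases i <;> simp
  rw [e]
  simpa using ((hasDerivAt_id t).smul_const (EuclideanSpace.single 1 (1 : ℝ) : Plane)).add_const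
    (!₂[s, 0] : Plane)

theorem deriv_slice_fst {φ : Plane → ℝ} (hφ : ContDiff ℝ 1 φ) (s t : ℝ) :
    deriv (fun s => φ !₂[s, t]) s = partialDeriv 0 φ !₂[s, t] :=
  (((hφ.differentiable one_ne_zero) _).hasFDerivAt.comp_hasDerivAt s
    (hasDerivAt_mk_fst s t)).deriv

theorem deriv_slice_snd {φ : Plane → ℝ} (hφ : ContDiff ℝ 1 φ) (s t : ℝ) :
    deriv (fun t => φ !₂[s, t]) t = partialDeriv 1 φ !₂[s, t] :=
  (((hφ.differentiable one_ne_zero) _).hasFDerivAt.comp_hasDerivAt t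
    (hasDerivAt_mk_snd s t)).deriv

/-! ### Step functions on a grid. -/

theorem memLp_comp_of_finite {ι : Type*} [Finite ι] [MeasurableSpace ι]
    [DiscreteMeasurableSpace ι] {q : Plane → ι} (hq : Measurable q) (c : ι → ℝ) :
    MemLp (fun x => c (q x)) 2 μΩ := by
  obtain ⟨C, hC⟩ := (Set.finite_range fun i => ‖c i‖).bddAbove
  exact MemLp.of_bound ((Measurable.of_discrete (f := c)).comp hq).aestronglyMeasurable C
    (.of_forall fun x => hC ⟨q x, rfl⟩)

/-- The functions on `Ω` that factor through `q`, as elements of `L²(Ω)`. -/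
noncomputable def stepMap {ι : Type*} [Finite ι] [MeasurableSpace ι] [DiscreteMeasurableSpace ι]
    {q : Plane → ι} (hq : Measurable q) : (ι → ℝ) →ₗ[ℝ] L2Ω where
  toFun c := (memLp_comp_of_finite hq c).toLp
  map_add' c d := by
    rw [← MemLp.toLp_add]
    rfl
  map_smul' r c := by
    rw [RingHom.id_apply, ← MemLp.toLp_const_smul]
    rfl

theorem coeFn_stepMap {ι : Type*} [Finite ι] [MeasurableSpace ι] [DiscreteMeasurableSpace ι]
    {q : Plane → ι} (hq : Measurable q) (c : ι → ℝ) :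
    stepMap hq c =ᵐ[μΩ] fun x => c (q x) :=
  (memLp_comp_of_finite hq c).coeFn_toLp

/-- The index of the cell of the grid of `(n + 1) × (m + 1)` equal rectangles containing `x`. -/
noncomputable def cellIndex (n m : ℕ) (x : Plane) : Fin (n + 1) × Fin (m + 1) :=
  (Fin.ofNat (n + 1) ⌊(n + 1 : ℝ) * x 0⌋₊, Fin.ofNat (m + 1) ⌊(m + 1 : ℝ) * x 1⌋₊)

theorem measurable_cellIndex (n m : ℕ) : Measurable (cellIndex n m) := by
  refine Measurable.prodMk ?_ ?_
  · exact (Measurable.of_discrete (f := Fin.ofNat (n + 1))).comp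
      (Nat.measurable_floor.comp (by fun_prop))
  · exact (Measurable.of_discrete (f := Fin.ofNat (m + 1))).comp
      (Nat.measurable_floor.comp (by fun_prop))

theorem mem_Icc_ofNat_floor (n : ℕ) {y : ℝ} (hy : y ∈ Ioo (0 : ℝ) 1) :
    y ∈ Icc ((Fin.ofNat (n + 1) ⌊(n + 1 : ℝ) * y⌋₊ : ℝ) / (n + 1))
      (((Fin.ofNat (n + 1) ⌊(n + 1 : ℝ) * y⌋₊ : ℝ) + 1) / (n + 1)) := by
  have hn : (0 : ℝ) < n + 1 := by positivity
  have h0 : 0 ≤ (n + 1 : ℝ) * y := (mul_pos hn hy.1).le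
  -- `Fin.ofNat` reduces modulo `n + 1`; for `y < 1` nothing is reduced.
  have hlt : ⌊(n + 1 : ℝ) * y⌋₊ < n + 1 := by
    rw [Nat.floor_lt h0]
    push_cast
    nlinarith [hy.2]
  have e : ((Fin.ofNat (n + 1) ⌊(n + 1 : ℝ) * y⌋₊ : ℕ) : ℝ) = (⌊(n + 1 : ℝ) * y⌋₊ : ℝ) := by
    rw [Fin.val_ofNat, Nat.mod_eq_of_lt hlt]
  rw [e, mem_Icc, div_le_iff₀ hn, le_div_iff₀ hn, mul_comm y]
  exact ⟨Nat.floor_le h0, (Nat.lt_floor_add_one _).le⟩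

/-! ### Vertical lines with controlled energy. -/

/-- Some slice has weighted energy at most the average over `(a, b)`; dividing by `h s ≥ c` removes
the weight. -/
theorem exists_slice_le {h : ℝ → ℝ} {c a b : ℝ} (hc : 0 < c) (ha : 0 ≤ a) (hab : a < b)
    (hb : b ≤ 1) (hch : ∀ t ∈ Icc a b, c ≤ h t) {u : H1 h} {φ : 𝓓(unitSquare, ℝ)}
    (hu : H1.toL2 u =ᵐ[μΩ] φ) :
    ∃ s ∈ Icc a b, ∫ t, partialDeriv 1 φ !₂[s, t] ^ 2 ∂unitMeasure
      ≤ ‖H1.weightedPartial 1 u‖ ^ 2 / (c * (b - a)) := by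
  set F : ℝ × ℝ → ℝ := fun p => (weight h 1 !₂[p.1, p.2] * partialDeriv 1 φ !₂[p.1, p.2]) ^ 2
  have hF : Integrable F (unitMeasure.prod unitMeasure) :=
    integrable_μΩ (memLp_weight_mul_partialDeriv 1 hu).integrable_sq
  set G : ℝ → ℝ := fun s => ∫ t, F (s, t) ∂unitMeasure with hG
  have hGi : Integrable G unitMeasure := hF.integral_prod_left
  have hGD : ∫ s, G s ∂unitMeasure = ‖H1.weightedPartial 1 u‖ ^ 2 := by
    rw [norm_sq_weightedPartial 1 hu, integral_μΩ, integral_prod _ hF]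
  have hsub : Ioo a b ⊆ Ioo (0 : ℝ) 1 := Ioo_subset_Ioo ha hb
  have hba : 0 < b - a := sub_pos.2 hab
  obtain ⟨s, hs, hsG⟩ := exists_le_setAverage (μ := volume) (s := Ioo a b) (f := G)
    (by simpa using hab) (by simp) (IntegrableOn.mono_set hGi hsub)
  refine ⟨s, Ioo_subset_Icc_self hs, ?_⟩
  have h1 : ∫ t in Ioo a b, G t ≤ ‖H1.weightedPartial 1 u‖ ^ 2 := by
    rw [← hGD]
    exact setIntegral_mono_set hGi
      (.of_forall fun _ => integral_nonneg fun _ => sq_nonneg _) hsub.eventuallyLE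
  have hcs := hch s (Ioo_subset_Icc_self hs)
  have h2 : G s = h s * ∫ t, partialDeriv 1 φ !₂[s, t] ^ 2 ∂unitMeasure := by
    rw [hG, ← integral_const_mul]
    refine integral_congr_ae (.of_forall fun t => ?_)
    simp only [F, mul_pow, weight]
    simp [Real.sq_sqrt (hc.le.trans hcs)]
  rw [setAverage_eq, h2, smul_eq_mul, Real.volume_real_Ioo_of_le hab.le] at hsG
  have h3 : 0 ≤ ∫ t, partialDeriv 1 φ !₂[s, t] ^ 2 ∂unitMeasure :=
    integral_nonneg fun _ => sq_nonneg _
  rw [inv_mul_eq_div, le_div_iff₀ hba] at hsG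
  rw [le_div_iff₀ (mul_pos hc hba)]
  nlinarith [mul_le_mul_of_nonneg_right hcs h3]

theorem partialDeriv_eq_zero (i : Fin 2) (φ : 𝓓(unitSquare, ℝ)) {x : Plane} (hx : x ∉ Ω) :
    partialDeriv i φ x = 0 := by
  have h : fderiv ℝ φ x = 0 := by
    by_contra h
    exact hx (φ.tsupport_subset (support_fderiv_subset ℝ h))
  rw [partialDeriv, h]
  rfl

theorem exists_nodes {h : ℝ → ℝ} {n : ℕ} {c : ℝ} (hc : 0 < c)
    (hch : ∀ t ∈ Icc (1 / (n + 1) : ℝ) 1, c ≤ h t) {u : H1 h} {φ : 𝓓(unitSquare, ℝ)}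
    (hu : H1.toL2 u =ᵐ[μΩ] φ) (j : Fin (n + 1)) :
    ∃ s ∈ Icc ((j : ℝ) / (n + 1)) (((j : ℝ) + 1) / (n + 1)),
      ∫ t, partialDeriv 1 φ !₂[s, t] ^ 2 ∂unitMeasure
        ≤ (n + 1) * ‖H1.weightedPartial 1 u‖ ^ 2 / c := by
  have hn : (0 : ℝ) < n + 1 := by positivity
  rcases Nat.eq_zero_or_pos (j : ℕ) with hj | hj
  -- The first column, where `h` has no positive lower bound: the edge `x₁ = 0` lies outside `Ω`, so
  -- the slice energy is zero.
  · refine ⟨0, by rw [hj]; constructor <;> [simp; (norm_num; positivity)], ?_⟩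
    have : ∀ t : ℝ, partialDeriv 1 φ !₂[0, t] = 0 := fun t =>
      partialDeriv_eq_zero 1 φ fun hx => lt_irrefl _ hx.1.1
    simp only [this]
    simp
    positivity
  · have hj1 : (1 : ℝ) ≤ j := by exact_mod_cast hj
    have hjn : (j : ℝ) + 1 ≤ n + 1 := by exact_mod_cast j.2
    have hlow : 1 / (n + 1 : ℝ) ≤ j / (n + 1) := by gcongr
    have hup : ((j : ℝ) + 1) / (n + 1) ≤ 1 := (div_le_one hn).2 hjn
    obtain ⟨s, hs, hs'⟩ := exists_slice_le (a := (j : ℝ) / (n + 1))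
      (b := ((j : ℝ) + 1) / (n + 1)) hc (by positivity) (by gcongr; linarith) hup
      (fun t ht => hch t ⟨hlow.trans ht.1, ht.2.trans hup⟩) hu
    refine ⟨s, hs, hs'.trans_eq ?_⟩
    field_simp
    ring

/-! ### The step approximation and its error. -/

theorem exists_step_approx {h : ℝ → ℝ} {n m : ℕ} {c : ℝ} (hc : 0 < c)
    (hch : ∀ t ∈ Icc (1 / (n + 1) : ℝ) 1, c ≤ h t) {u : H1 h} {φ : 𝓓(unitSquare, ℝ)}
    (hu : H1.toL2 u =ᵐ[μΩ] φ) :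
    ∃ d, ‖H1.toL2 u - stepMap (measurable_cellIndex n m) d‖ ^ 2
      ≤ 2 / (n + 1) * ‖H1.weightedPartial 0 u‖ ^ 2
        + 2 * (n + 1) / (c * (m + 1)) * ‖H1.weightedPartial 1 u‖ ^ 2 := by
  have hn : (0 : ℝ) < n + 1 := by positivity
  have hm : (0 : ℝ) < m + 1 := by positivity
  have hφ : ContDiff ℝ 1 φ := φ.contDiff.of_le (by simp)
  choose s hs hsB using exists_nodes hc hch hu
  -- The node of a cell is on the chosen line of its column, at the height of its lower edge.
  let d : Fin (n + 1) × Fin (m + 1) → ℝ := fun p => φ !₂[s p.1, (p.2 : ℝ) / (m + 1)]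
  refine ⟨d, ?_⟩
  set D := ‖H1.weightedPartial 1 u‖ ^ 2
  set A : ℝ → ℝ := fun t => ∫ s, partialDeriv 0 φ !₂[s, t] ^ 2 ∂unitMeasure with hA
  have hFi : Integrable (fun p : ℝ × ℝ => partialDeriv 0 φ !₂[p.1, p.2] ^ 2)
      (unitMeasure.prod unitMeasure) := by
    have := integrable_μΩ (memLp_weight_mul_partialDeriv 0 hu).integrable_sq
    simpa [weight] using this
  have hAi : Integrable A unitMeasure := hFi.integral_prod_right
  have hAint : ∫ t, A t ∂unitMeasure = ‖H1.weightedPartial 0 u‖ ^ 2 := by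
    rw [norm_sq_weightedPartial 0 hu, integral_μΩ, ← integral_prod_symm _ hFi]
    simp [weight]
  have hsmem : ∀ j, s j ∈ Icc (0 : ℝ) 1 := fun j => by
    have h1 : (j : ℝ) + 1 ≤ n + 1 := by exact_mod_cast j.2
    exact ⟨le_trans (by positivity) (hs j).1, (hs j).2.trans ((div_le_one hn).2 h1)⟩
  have hpt : ∀ x₁ ∈ Ioo (0 : ℝ) 1, ∀ x₂ ∈ Ioo (0 : ℝ) 1,
      (φ !₂[x₁, x₂] - d (cellIndex n m !₂[x₁, x₂])) ^ 2
        ≤ 2 / (n + 1) * A x₂ + 2 * (n + 1) / (c * (m + 1)) * D := by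
    intro x₁ hx₁ x₂ hx₂
    set j := Fin.ofNat (n + 1) ⌊(n + 1 : ℝ) * x₁⌋₊ with hj
    set k := Fin.ofNat (m + 1) ⌊(m + 1 : ℝ) * x₂⌋₊ with hk
    have ed : d (cellIndex n m !₂[x₁, x₂]) = φ !₂[s j, (k : ℝ) / (m + 1)] := rfl
    have hjx := mem_Icc_ofNat_floor n hx₁
    have hkx := mem_Icc_ofNat_floor m hx₂
    rw [← hj] at hjx
    rw [← hk] at hkx
    have hsj := hs j
    have b1 : |x₁ - s j| ≤ 1 / (n + 1) := by
      have := abs_sub_le_of_le_of_le hjx.1 hjx.2 hsj.1 hsj.2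
      rwa [← sub_div, add_sub_cancel_left] at this
    have b2 : |x₂ - k / (m + 1)| ≤ 1 / (m + 1) := by
      rw [abs_of_nonneg (sub_nonneg.2 hkx.1), sub_le_iff_le_add, ← add_div, add_comm (1 : ℝ)]
      exact hkx.2
    have hkmem : (k : ℝ) / (m + 1) ∈ Icc (0 : ℝ) 1 :=
      ⟨by positivity, hkx.1.trans hx₂.2.le⟩
    have i1 := sq_sub_le_abs_mul_integral_deriv_sq (g := fun s => φ !₂[s, x₂])
      (hφ.comp (contDiff_mk_fst x₂)) (hsmem j) (Ioo_subset_Icc_self hx₁)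
    have i2 := sq_sub_le_abs_mul_integral_deriv_sq (g := fun t => φ !₂[s j, t])
      (hφ.comp (contDiff_mk_snd (s j))) hkmem (Ioo_subset_Icc_self hx₂)
    simp only [deriv_slice_fst hφ] at i1
    simp only [deriv_slice_snd hφ] at i2
    have j1 : (φ !₂[x₁, x₂] - φ !₂[s j, x₂]) ^ 2 ≤ 1 / (n + 1) * A x₂ :=
      i1.trans (mul_le_mul_of_nonneg_right b1 (integral_nonneg fun _ => sq_nonneg _))
    have j2 : (φ !₂[s j, x₂] - φ !₂[s j, (k : ℝ) / (m + 1)]) ^ 2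
        ≤ 1 / (m + 1) * ((n + 1) * D / c) :=
      i2.trans (mul_le_mul b2 (hsB j) (integral_nonneg fun _ => sq_nonneg _) (by positivity))
    rw [ed]
    have e1 : 2 / (n + 1) * A x₂ + 2 * (n + 1) / (c * (m + 1)) * D
        = 2 * (1 / (n + 1) * A x₂) + 2 * (1 / (m + 1) * ((n + 1) * D / c)) := by
      field_simp
    rw [e1]
    -- This is `(a + b)² ≤ 2a² + 2b²` for the horizontal increment `a` and the vertical increment
    -- `b`.
    nlinarith [sq_nonneg ((φ !₂[x₁, x₂] - φ !₂[s j, x₂])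
      - (φ !₂[s j, x₂] - φ !₂[s j, (k : ℝ) / (m + 1)]))]
  have hae : (fun x => (H1.toL2 u - stepMap (measurable_cellIndex n m) d) x ^ 2)
      =ᵐ[μΩ] fun x => (φ x - d (cellIndex n m x)) ^ 2 := by
    filter_upwards [Lp.coeFn_sub (H1.toL2 u) (stepMap (measurable_cellIndex n m) d), hu,
      coeFn_stepMap (measurable_cellIndex n m) d] with x h1 h2 h3
    rw [h1, Pi.sub_apply, h2, h3]
  have hi := integrable_μΩ ((Lp.memLp (H1.toL2 u - stepMap (measurable_cellIndex n m) d)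
    ).integrable_sq.congr hae)
  rw [norm_sq_L2Ω, integral_congr_ae hae, integral_μΩ]
  have hAi' : Integrable (fun p : ℝ × ℝ => 2 / (n + 1) * A p.2)
      (unitMeasure.prod unitMeasure) := (hAi.comp_snd unitMeasure).const_mul _
  calc _ ≤ ∫ p : ℝ × ℝ, (2 / (n + 1) * A p.2 + 2 * (n + 1) / (c * (m + 1)) * D)
        ∂(unitMeasure.prod unitMeasure) := by
        refine integral_mono_ae hi (hAi'.add (integrable_const _)) ?_
        rw [unitMeasure, Measure.prod_restrict]
        filter_upwards [ae_restrict_mem (measurableSet_Ioo.prod measurableSet_Ioo)] with p hp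
        exact hpt p.1 hp.1 p.2 hp.2
    _ = _ := by
        rw [integral_add hAi' (integrable_const _), integral_const_mul, integral_fun_snd, hAint]
        simp

theorem exists_finiteDimensional_approx {h : ℝ → ℝ} (h_pos : ∀ t ∈ Ioc (0 : ℝ) 1, 0 < h t)
    (h_cont : ContinuousOn h (Ioc (0 : ℝ) 1)) (R : ℝ) {ε : ℝ} (hε : 0 < ε) :
    ∃ V : Submodule ℝ L2Ω, FiniteDimensional ℝ V ∧
      ∀ u ∈ H1.testFunctions h, ‖u‖ ≤ R → ∃ v ∈ V, ‖H1.toL2 u - v‖ < ε := by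
  have hε2 : 0 < ε ^ 2 / 2 := by positivity
  -- The order matters: `n` settles the horizontal term and fixes `c`, and only then is `m` chosen,
  -- depending on both.
  obtain ⟨n, hn⟩ := exists_nat_gt (2 * R ^ 2 / (ε ^ 2 / 2))
  have hn0 : (0 : ℝ) < n + 1 := by positivity
  have hsub : Icc (1 / (n + 1) : ℝ) 1 ⊆ Ioc 0 1 := fun t ht =>
    ⟨lt_of_lt_of_le (by positivity) ht.1, ht.2⟩
  obtain ⟨t₀, ht₀, hmin⟩ := isCompact_Icc.exists_isMinOn
    (nonempty_Icc.2 ((div_le_one hn0).2 (by linarith [n.cast_nonneg (α := ℝ)])))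
    (h_cont.mono hsub)
  set c := h t₀
  have hc : 0 < c := h_pos t₀ (hsub ht₀)
  obtain ⟨m, hm⟩ := exists_nat_gt (2 * (n + 1) / c * R ^ 2 / (ε ^ 2 / 2))
  refine ⟨LinearMap.range (stepMap (measurable_cellIndex n m)), inferInstance, ?_⟩
  rintro u ⟨φ, hu⟩ huR
  obtain ⟨d, hd⟩ := exists_step_approx (m := m) hc (fun t ht => hmin ht) hu
  refine ⟨_, ⟨d, rfl⟩, lt_of_pow_lt_pow_left₀ 2 hε.le (hd.trans_lt ?_)⟩
  have hm0 : (0 : ℝ) < m + 1 := by positivity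
  have hw (i : Fin 2) : ‖H1.weightedPartial i u‖ ^ 2 ≤ R ^ 2 :=
    pow_le_pow_left₀ (norm_nonneg _) ((norm_weightedPartial_le i u).trans huR) 2
  have h1 : 2 / (n + 1) * ‖H1.weightedPartial 0 u‖ ^ 2 < ε ^ 2 / 2 := by
    refine (mul_le_mul_of_nonneg_left (hw 0) (by positivity)).trans_lt ?_
    rw [div_mul_eq_mul_div, div_lt_iff₀ hn0]
    rw [div_lt_iff₀ hε2] at hn
    nlinarith
  have h2 : 2 * (n + 1) / (c * (m + 1)) * ‖H1.weightedPartial 1 u‖ ^ 2 < ε ^ 2 / 2 := by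
    refine (mul_le_mul_of_nonneg_left (hw 1) (by positivity)).trans_lt ?_
    rw [← div_div, div_mul_eq_mul_div, div_lt_iff₀ hm0]
    rw [div_lt_iff₀ hε2] at hm
    nlinarith
  linarith

/-! ### Injectivity and compactness. -/

theorem embedding_injective (h : ℝ → ℝ) : Function.Injective (embedding h) :=
  fun _ _ huv => Subtype.ext (Subtype.ext huv)

theorem isCompactOperator_embedding {h : ℝ → ℝ} (h_pos : ∀ t ∈ Ioc (0 : ℝ) 1, 0 < h t)
    (h_cont : ContinuousOn h (Ioc (0 : ℝ) 1)) : IsCompactOperator (embedding h) := by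
  refine (isCompactOperator_iff_isCompact_closure_image_ball
    (embedding h : H10 h →ₗ[ℝ] L2Ω) one_pos).2 ?_
  refine TotallyBounded.isCompact_of_isClosed (TotallyBounded.closure ?_) isClosed_closure
  refine totallyBounded_of_approx_finiteDimensional ?_ fun ε hε => ?_
  · exact (embedding h).lipschitz.isBounded_image Metric.isBounded_ball
  · obtain ⟨V, hV, happ⟩ := exists_finiteDimensional_approx h_pos h_cont 2 (half_pos hε)
    refine ⟨V, hV, ?_⟩
    rintro _ ⟨u, hu, rfl⟩
    have hucl : (u : H1 h) ∈ closure (H1.testFunctions h : Set (H1 h)) := u.2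
    -- Distance below `1` keeps `w` in the ball of radius `2` handled by `happ`; distance below `ε /
    -- 2` leaves the other half of `ε` for approximating `w`.
    obtain ⟨w, hw, huw⟩ := Metric.mem_closure_iff.1 hucl (min 1 (ε / 2))
      (lt_min one_pos (half_pos hε))
    rw [dist_eq_norm] at huw
    have hu1 : ‖(u : H1 h)‖ < 1 := mem_ball_zero_iff.1 hu
    have hw2 : ‖w‖ ≤ 2 := by
      have h1 := norm_sub_le (u : H1 h) (u - w)
      rw [sub_sub_cancel] at h1
      linarith [huw.trans_le (min_le_left _ _)]
    obtain ⟨v, hv, hwv⟩ := happ w hw hw2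
    refine ⟨v, hv, ?_⟩
    have h1 : ‖H1.toL2 (u : H1 h) - H1.toL2 w‖ < ε / 2 := by
      rw [← map_sub]
      exact (H1.norm_toL2_le _).trans_lt (huw.trans_le (min_le_right _ _))
    have h2 := norm_sub_le_norm_sub_add_norm_sub (H1.toL2 (u : H1 h)) (H1.toL2 w) v
    exact h2.trans_lt (by linarith)

end WeightedSobolev

theorem mainTheorem3 (h : ℝ → ℝ)
    (h_bdd : ∃ M : ℝ, ∀ t ∈ Set.Icc (0 : ℝ) 1, |h t| ≤ M)
    (h_zero : h 0 = 0)
    (h_pos : ∀ t ∈ Set.Ioc (0 : ℝ) 1, 0 < h t)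
    (h_smooth : ContDiffOn ℝ 1 h (Set.Ioc (0 : ℝ) 1))
    (θ : ℝ) (hθ_pos : 0 < θ) (hθ_lt : θ < 1)
    (h_ball : ∃ C : ℝ, ∀ x ∈ WeightedSobolev.Ω, ∀ r : ℝ,
      0 < r → r ≤ Metric.diam WeightedSobolev.Ω →
        MeasureTheory.IntegrableOn (fun y : WeightedSobolev.Plane => (h (y 0))⁻¹)
            (Metric.ball x r ∩ WeightedSobolev.Ω) ∧
          (∫ y in Metric.ball x r ∩ WeightedSobolev.Ω, (h (y 0))⁻¹) /
              MeasureTheory.volume.real (Metric.ball x r ∩ WeightedSobolev.Ω) ^ θ ≤ C) :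
    Function.Injective (WeightedSobolev.embedding h) ∧
      IsCompactOperator (WeightedSobolev.embedding h) :=
  ⟨WeightedSobolev.embedding_injective h,
    WeightedSobolev.isCompactOperator_embedding h_pos h_smooth.continuousOn⟩
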